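/- Let $m,n\ge 1$ be integers. For $f\in\mathbb C[x]$ let $\Sigma_f=\{f(x): f'(x)=0\}$ be its set of critical values. Let $D\subset\mathbb C\setminus\Sigma_f$ be a simply connected domain and let $x,y:D\to\mathbb C$ be continuous functions with $f(x(t))=f(y(t))=t$ and $x(t)\ne y(t)$ for all $t\in D$ (so that $\gamma(t)=x(t)-y(t)$ is a continuous family of simple cycles in $H_0(f^{-1}(t),\mathbb Z)$). For $\omega\in\mathbb C[x]$ consider the zero-dimensional Abelian integral $$I(t)=\int_{\gamma(t)}\omega=\omega(x(t))-\omega(y(t)),\qquad t\in D .$$ Let $Z(m,n,\mathbb C,0)$ be the supremum of the number of (distinct) zeros of $I$ in $D$, over all $f$ with $\deg f\le m$, all $\omega$ with $\deg\omega\le n$, all such $D$ and all such $\gamma$ for which $I$ is not identically zero on $D$ (the supremum is $0$ if there are none, which happens for $m=1$). Then $$n-1-\Big[\frac nm\Big]\;\le\; Z(m,n,\mathbb C,0)\;\le\;\frac{(m-1)(n-1)}{2},$$ where $[\,\cdot\,]$ denotes the integer part. -/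

import Mathlib

noncomputable section

namespace ZeroDimHilbert

/-- The set `Σ` of critical values of the polynomial map `f : ℂ → ℂ`. -/
def criticalValues (f : Polynomial ℂ) : Set ℂ :=
  {t | ∃ x : ℂ, f.derivative.eval x = 0 ∧ f.eval x = t}

/-- The fibre `L_t = f⁻¹(t)`. -/
def fibre (f : Polynomial ℂ) (t : ℂ) : Set ℂ :=
  {x | f.eval x = t}

/-- The integral of the polynomial `0`-form `ω` over the `0`-chain `γ = ∑ nᵢ xᵢ`
with integer coefficients, namely `∑ nᵢ ω(xᵢ)`. -/
def integral (γ : ℂ →₀ ℤ) (ω : Polynomial ℂ) : ℂ :=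
  γ.sum fun x k => (k : ℂ) * ω.eval x

/-- `γ` is a continuous family, over `D`, of simple cycles `γ(t) = x(t) - y(t)` in the fibres
of `f`: the two points `x(t) ≠ y(t)` of `f⁻¹(t)` depend continuously on `t ∈ D`. -/
def IsSimpleCycleFamily (f : Polynomial ℂ) (D : Set ℂ) (γ : ℂ → ℂ →₀ ℤ) : Prop :=
  ∃ x y : ℂ → ℂ, ContinuousOn x D ∧ ContinuousOn y D ∧
    ∀ t ∈ D, x t ∈ fibre f t ∧ y t ∈ fibre f t ∧ x t ≠ y t ∧
      γ t = Finsupp.single (x t) 1 - Finsupp.single (y t) 1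

/-- A simply connected (in particular non-empty and connected) open subset of `ℂ`. -/
def IsSimplyConnectedDomain (D : Set ℂ) : Prop :=
  IsOpen D ∧ IsSimplyConnected D

/-- The possible numbers of distinct zeros `t ∈ K ∩ D` of the Abelian integrals
`I(t) = ∫_{γ(t)} ω`, not identically zero on `D`, where `f, ω` are polynomials with coefficients
in the subfield `K ⊆ ℂ`, `deg f ≤ m`, `deg ω ≤ n`, `D` is a simply connected domain that avoids
the critical values of `f`, and `γ` is a continuous family over `D` of simple cycles of `f`. -/
def zeroCounts (m n : ℕ) (K : Subfield ℂ) : Set ℕ∞ :=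
  {N | ∃ (f ω : Polynomial ℂ) (D : Set ℂ) (γ : ℂ → ℂ →₀ ℤ),
    (∀ i, f.coeff i ∈ K) ∧ (∀ i, ω.coeff i ∈ K) ∧
    f.natDegree ≤ m ∧ ω.natDegree ≤ n ∧
    IsSimplyConnectedDomain D ∧ Disjoint D (criticalValues f) ∧
    IsSimpleCycleFamily f D γ ∧
    (∃ t ∈ D, integral (γ t) ω ≠ 0) ∧
    N = Set.encard {t | t ∈ K ∧ t ∈ D ∧ integral (γ t) ω = 0}}

/-- `Z(m, n, K, 0)`: the exact upper bound (least upper bound, a priori possibly infinite) of the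
number of zeros. -/
def Z (m n : ℕ) (K : Subfield ℂ) : ℕ∞ :=
  sSup (zeroCounts m n K)

end ZeroDimHilbert

end

/-! Upper bound: let `P` and `Q` be the divided differences of `f` and `ω`, of degrees at most `m -
1` and `n - 1`. A zero `t` of `I` gives two common zeros of `P` and `Q`, namely `(x(t), y(t))` and
its mirror image, so Bézout would give `(m - 1)(n - 1) / 2`. If `P = R A` and `Q = R B` with `A`,
`B` coprime, then `R` and `A` never vanish together along the path, since `x(t)` is not critical. As
`D` is connected, one of them vanishes throughout; `I ≢ 0` excludes `R`. Bézout is then applied to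
`A` and `B` (`two_mul_card_zeros_le`).

Lower bound: for `f = x ^ m` and `y = ζ x`, the integral is a polynomial in `x(t)` with free
coefficients at the exponents up to `n` not divisible by `m`. Linear algebra makes it vanish at one
point fewer than there are coefficients (`exists_mem_zeroCounts_ge`). -/

namespace MvPolynomial

open Module

variable {K : Type*} [Field K]

/-! ### Bézout's inequality by counting dimensions. -/

theorem two_mul_finrank_restrictTotalDegree_fin_two (d : ℕ) :
    2 * finrank K (restrictTotalDegree (Fin 2) K d) = (d + 1) * (d + 2) := by
  let e : {s : Fin 2 →₀ ℕ | (s.sum fun _ k => k) ≤ d} ≃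
      ((Finset.range (d + 1)).sigma fun k =>
        (Finset.HasAntidiagonal.antidiagonal k : Finset (ℕ × ℕ))) :=
    { toFun := fun s => ⟨⟨s.1 0 + s.1 1, s.1 0, s.1 1⟩, by
        have := s.2
        simp [Finsupp.sum_fintype] at this
        simp; omega⟩
      invFun := fun p => ⟨Finsupp.equivFunOnFinite.symm ![p.1.2.1, p.1.2.2], by
        have := Finset.mem_sigma.1 p.2
        simp at this
        simp [Finsupp.sum_fintype, this.2]; omega⟩
      left_inv := by
        rintro ⟨s, hs⟩
        ext i
        fin_cases i <;> simp
      right_inv := by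
        rintro ⟨⟨k, i, j⟩, hp⟩
        simp at hp
        obtain ⟨h1, rfl⟩ := hp
        simp }
  have h : finrank K (restrictTotalDegree (Fin 2) K d) =
      ∑ k ∈ Finset.range (d + 1), (k + 1) := by
    rw [restrictTotalDegree, finrank_eq_nat_card_basis (basisRestrictSupport K _), Nat.card_congr e,
      Nat.card_eq_fintype_card, Fintype.card_coe, Finset.card_sigma]
    simp
  rw [h]
  clear h e
  induction d with
  | zero => simp
  | succ d ih => rw [Finset.sum_range_succ, mul_add, ih]; ring

/-- Distinct points of affine space are separated by polynomials. -/
theorem exists_eval_eq_one_and_eq_zero {σ : Type*} (S : Finset (σ → K)) (s : σ → K) :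
    ∃ e : MvPolynomial σ K, eval s e = 1 ∧ ∀ t ∈ S, t ≠ s → eval t e = 0 := by
  classical
  have h : ∀ t : σ → K, ∃ l : MvPolynomial σ K, t ≠ s → eval s l = 1 ∧ eval t l = 0 := by
    intro t
    by_cases hts : t = s
    · exact ⟨0, fun h => absurd hts h⟩
    · obtain ⟨i, hi⟩ := Function.ne_iff.1 hts
      refine ⟨C ((s i - t i)⁻¹) * (X i - C (t i)), fun _ => ⟨?_, by simp⟩⟩
      have : s i - t i ≠ 0 := sub_ne_zero.2 (Ne.symm hi)
      simp [this]
  choose l hl using h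
  refine ⟨∏ t ∈ S.erase s, l t, ?_, ?_⟩
  · rw [map_prod]
    exact Finset.prod_eq_one fun t ht => (hl t (Finset.ne_of_mem_erase ht)).1
  · intro t ht hts
    rw [map_prod]
    exact Finset.prod_eq_zero (Finset.mem_erase.2 ⟨hts, ht⟩) (hl t hts).2

/-- On a finite set every function is the restriction of a polynomial of bounded degree. -/
theorem exists_restrictTotalDegree_surjective {σ : Type*} (S : Finset (σ → K)) :
    ∃ d₀, ∀ d, d₀ ≤ d → ∀ g : S → K, ∃ P ∈ restrictTotalDegree σ K d,
      ∀ s : S, eval s.1 P = g s := by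
  classical
  choose e he1 he0 using fun s : S => exists_eval_eq_one_and_eq_zero S s.1
  refine ⟨Finset.univ.sup fun s => (e s).totalDegree, fun d hd g =>
    ⟨∑ s, g s • e s, ?_, fun s => ?_⟩⟩
  · refine Submodule.sum_mem _ fun s _ => Submodule.smul_mem _ _ ?_
    rw [mem_restrictTotalDegree]
    exact (Finset.le_sup (f := fun s => (e s).totalDegree) (Finset.mem_univ s)).trans hd
  · rw [map_sum, Finset.sum_eq_single s]
    · simp [he1]
    · intro t _ hts
      rw [smul_eval, he0 t s.1 s.2 (fun h => hts (Subtype.ext h.symm)), mul_zero]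
    · simp

/-- Multiplication by `P`, from polynomials of degree at most `d` to those of degree at
most `d'`. -/
noncomputable def mulRestrictTotalDegree {σ : Type*} (P : MvPolynomial σ K) {d d' : ℕ}
    (h : P.totalDegree + d ≤ d') :
    restrictTotalDegree σ K d →ₗ[K] restrictTotalDegree σ K d' :=
  (LinearMap.mulLeft K P).restrict fun A hA => by
    rw [mem_restrictTotalDegree] at hA ⊢
    exact (totalDegree_mul _ _).trans (by omega)

@[simp]
theorem coe_mulRestrictTotalDegree {σ : Type*} (P : MvPolynomial σ K) {d d' : ℕ}
    (h : P.totalDegree + d ≤ d') (A : restrictTotalDegree σ K d) :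
    (mulRestrictTotalDegree P h A : MvPolynomial σ K) = P * A :=
  rfl

/-- Euler characteristic inequality for `U → V → W → X`: the rank of `ψ` is at least `dim V - dim U`
and at most `dim W - dim X`. -/
theorem _root_.LinearMap.finrank_add_le_of_range_le_of_ker_le {U V W X : Type*} [AddCommGroup U]
    [Module K U] [AddCommGroup V] [Module K V] [AddCommGroup W] [Module K W] [AddCommGroup X]
    [Module K X] [FiniteDimensional K U] [FiniteDimensional K V] [FiniteDimensional K W]
    (φ : U →ₗ[K] V) (ψ : V →ₗ[K] W) (ev : W →ₗ[K] X) (hφ : LinearMap.ker ψ ≤ LinearMap.range φ)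
    (hψ : LinearMap.range ψ ≤ LinearMap.ker ev) (hev : LinearMap.range ev = ⊤) :
    finrank K X + finrank K V ≤ finrank K W + finrank K U := by
  have h1 := ev.finrank_range_add_finrank_ker
  have h2 := ψ.finrank_range_add_finrank_ker
  have h3 := Submodule.finrank_mono hψ
  have h4 := Submodule.finrank_mono hφ
  have h5 := φ.finrank_range_le
  rw [hev, finrank_top] at h1
  omega

/-- **Bézout's inequality** in the plane: two polynomials without a common factor have at most
`deg P * deg Q` common zeros. -/
theorem card_le_totalDegree_mul_of_isRelPrime {P Q : MvPolynomial (Fin 2) K}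
    (hQ : Q ≠ 0) (hPQ : IsRelPrime P Q) (S : Finset (Fin 2 → K))
    (hS : ∀ s ∈ S, eval s P = 0 ∧ eval s Q = 0) :
    S.card ≤ P.totalDegree * Q.totalDegree := by
  obtain ⟨e, he⟩ := exists_restrictTotalDegree_surjective S
  obtain ⟨p, hp⟩ : ∃ p, P.totalDegree = p := ⟨_, rfl⟩
  obtain ⟨q, hq⟩ : ∃ q, Q.totalDegree = q := ⟨_, rfl⟩
  -- The Koszul complex of `(P, Q)`, truncated by degree and followed by evaluation on `S`; `e` is
  -- large enough for that evaluation to be onto.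
  let ev : restrictTotalDegree (Fin 2) K (p + q + e) →ₗ[K] (S → K) :=
    (LinearMap.pi fun s : S => (aeval (R := K) s.1).toLinearMap) ∘ₗ Submodule.subtype _
  let ψ := (mulRestrictTotalDegree P (d := q + e) (d' := p + q + e) (by omega)).coprod
    (mulRestrictTotalDegree Q (d := p + e) (d' := p + q + e) (by omega))
  let φ := (mulRestrictTotalDegree Q (d := e) (d' := q + e) (by omega)).prod
    (-mulRestrictTotalDegree P (d := e) (d' := p + e) (by omega))
  have ev_apply : ∀ A s, ev A s = eval s.1 (A : MvPolynomial (Fin 2) K) := fun A s => by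
    rw [← aeval_eq_eval]; rfl
  have hev : LinearMap.range ev = ⊤ := by
    rw [LinearMap.range_eq_top]
    intro g
    obtain ⟨R, hR, hRg⟩ := he (p + q + e) (by omega) g
    refine ⟨⟨R, hR⟩, ?_⟩
    funext s
    rw [ev_apply, hRg]
  have hψ : LinearMap.range ψ ≤ LinearMap.ker ev := by
    rintro _ ⟨⟨A, B⟩, rfl⟩
    rw [LinearMap.mem_ker]
    funext s
    simp [ev_apply, ψ, (hS s.1 s.2).1, (hS s.1 s.2).2]
  have hφ : LinearMap.ker ψ ≤ LinearMap.range φ := by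
    rintro ⟨⟨A, hA⟩, ⟨B, hB⟩⟩ h
    have h : P * A + Q * B = 0 := by
      rw [LinearMap.mem_ker, Subtype.ext_iff] at h
      simpa [ψ] using h
    obtain ⟨R, rfl⟩ : Q ∣ A := hPQ.symm.dvd_of_dvd_mul_left ⟨-B, by linear_combination h⟩
    obtain rfl : B = -(P * R) := mul_left_cancel₀ hQ (by linear_combination h)
    have hR : R ∈ restrictTotalDegree (Fin 2) K e := by
      rw [mem_restrictTotalDegree] at hA ⊢
      by_cases hR0 : R = 0
      · simp [hR0]
      · rw [totalDegree_mul_of_isDomain hQ hR0] at hA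
        omega
    exact ⟨⟨R, hR⟩, Prod.ext (Subtype.ext (by simp [φ])) (Subtype.ext (by simp [φ]))⟩
  have h := LinearMap.finrank_add_le_of_range_le_of_ker_le φ ψ ev hφ hψ hev
  rw [finrank_prod, finrank_fintype_fun_eq_card, Fintype.card_coe] at h
  -- With `h(d) = (d + 1)(d + 2) / 2`, the combination `h(p + q + e) - h(q + e) - h(p + e) + h(e)`
  -- equals `p q`.
  have k1 := two_mul_finrank_restrictTotalDegree_fin_two (K := K) (p + q + e)
  have k2 := two_mul_finrank_restrictTotalDegree_fin_two (K := K) (q + e)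
  have k3 := two_mul_finrank_restrictTotalDegree_fin_two (K := K) (p + e)
  have k4 := two_mul_finrank_restrictTotalDegree_fin_two (K := K) e
  rw [hp, hq]
  nlinarith

/-! ### Divided differences. -/

theorem totalDegree_aeval_X_le {σ : Type*} (i : σ) (f : Polynomial K) :
    (Polynomial.aeval (X i : MvPolynomial σ K) f).totalDegree ≤ f.natDegree := by
  rw [Polynomial.aeval_eq_sum_range]
  refine totalDegree_finsetSum_le fun k hk => (totalDegree_smul_le _ _).trans ?_
  rw [totalDegree_X_pow]
  exact Nat.lt_succ_iff.1 (Finset.mem_range.1 hk)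

theorem eval_polynomial_aeval_X {σ : Type*} (i : σ) (f : Polynomial K) (s : σ → K) :
    eval s (Polynomial.aeval (X i : MvPolynomial σ K) f) = f.eval (s i) := by
  rw [← coe_aeval_eq_eval, RingHom.coe_coe, ← Polynomial.aeval_algHom_apply, aeval_X]
  simp [Polynomial.aeval_def]

/-- The divided difference `(f(x) - f(y)) / (x - y)`. -/
theorem exists_dividedDifference (f : Polynomial K) (hf : f.natDegree ≠ 0) :
    ∃ P : MvPolynomial (Fin 2) K, P ≠ 0 ∧ P.totalDegree ≤ f.natDegree - 1 ∧
      Polynomial.aeval (X 0) f - Polynomial.aeval (X 1) f = (X 0 - X 1) * P := by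
  have hX : (X 0 - X 1 : MvPolynomial (Fin 2) K) ≠ 0 := by
    rw [sub_ne_zero]
    exact fun h => absurd (X_injective h) (by decide)
  obtain ⟨P, hP⟩ : (X 0 - X 1 : MvPolynomial (Fin 2) K) ∣
      Polynomial.aeval (X 0) f - Polynomial.aeval (X 1) f := by
    rw [Polynomial.aeval_def, Polynomial.aeval_def, ← Polynomial.eval_map, ← Polynomial.eval_map]
    exact Polynomial.sub_dvd_eval_sub _ _ _
  have hP0 : P ≠ 0 := by
    rintro rfl
    rw [mul_zero, sub_eq_zero] at hP
    -- Setting the second variable to `0` gives `f = f(0)`, a constant.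
    have h := congrArg (aeval ![Polynomial.X, (0 : Polynomial K)]) hP
    rw [← Polynomial.aeval_algHom_apply, ← Polynomial.aeval_algHom_apply, aeval_X, aeval_X] at h
    simp only [Matrix.cons_val_zero, Matrix.cons_val_one, Polynomial.aeval_X_left_apply] at h
    have h0 : Polynomial.aeval (0 : Polynomial K) f = Polynomial.C (f.coeff 0) := by
      rw [← map_zero Polynomial.C, ← Polynomial.algebraMap_eq, Polynomial.aeval_algebraMap_apply]
      simp [Polynomial.coeff_zero_eq_eval_zero]
    rw [h0] at h
    rw [h] at hf
    simp at hf
  refine ⟨P, hP0, ?_, hP⟩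
  have h := congrArg totalDegree hP
  have h1 : (X 0 - X 1 : MvPolynomial (Fin 2) K).totalDegree ≠ 0 := by
    intro h
    rw [totalDegree_eq_zero_iff_eq_C] at h
    have h0 := congrArg (eval ![0, 0]) h
    have h1 := congrArg (eval ![1, 0]) h
    simp only [map_sub, eval_X, eval_C] at h0 h1
    rw [← h0] at h1
    simp at h1
  rw [totalDegree_mul_of_isDomain hX hP0] at h
  have h2 := (totalDegree_sub (Polynomial.aeval (X 0 : MvPolynomial (Fin 2) K) f)
    (Polynomial.aeval (X 1) f)).trans
    (max_le (totalDegree_aeval_X_le 0 f) (totalDegree_aeval_X_le 1 f))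
  omega

/-- If `f(x) - f(y) = (x - y) R(x, y) A(x, y)` and `x` is not a critical point of `f`, then `R`
and `A` do not both vanish at `(x, y)`. -/
theorem derivative_eval_eq_zero_of_factors_eq_zero {f : Polynomial K}
    {R A : MvPolynomial (Fin 2) K}
    (h : Polynomial.aeval (X 0) f - Polynomial.aeval (X 1) f = (X 0 - X 1) * (R * A)) {x y : K}
    (hR : eval ![x, y] R = 0) (hA : eval ![x, y] A = 0) : f.derivative.eval x = 0 := by
  -- With `y` frozen, `f - f(y) = (X - y) R A` in one variable; every term of the derivative of the
  -- right side keeps a factor `R` or `A`, which vanishes at `x`.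
  have h1 := congrArg (aeval ![Polynomial.X, Polynomial.C y]) h
  have key : ∀ B : MvPolynomial (Fin 2) K,
      Polynomial.eval x (aeval ![Polynomial.X, Polynomial.C y] B) = eval ![x, y] B := by
    intro B
    have : ((Polynomial.aeval x : Polynomial K →ₐ[K] K).comp
        (aeval ![Polynomial.X, Polynomial.C y])) = aeval ![x, y] := by
      ext i
      fin_cases i <;> simp
    simpa [aeval_eq_eval] using DFunLike.congr_fun this B
  rw [map_sub, ← Polynomial.aeval_algHom_apply, ← Polynomial.aeval_algHom_apply] at h1
  simp only [aeval_X, Matrix.cons_val_zero, Matrix.cons_val_one, Polynomial.aeval_X_left_apply,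
    map_mul, map_sub] at h1
  rw [← Polynomial.algebraMap_eq, Polynomial.aeval_algebraMap_apply, Polynomial.algebraMap_eq]
    at h1
  have h2 := congrArg (fun g => Polynomial.eval x (Polynomial.derivative g)) h1
  simp only [Polynomial.derivative_sub, Polynomial.derivative_mul, Polynomial.derivative_C,
    Polynomial.eval_sub, Polynomial.eval_add, Polynomial.eval_mul, key, hR, hA] at h2
  simpa using h2

end MvPolynomial

namespace ZeroDimHilbert

open MvPolynomial

/-! ### The upper bound. -/

theorem integral_single_sub_single (x y : ℂ) (ω : Polynomial ℂ) :
    integral (Finsupp.single x 1 - Finsupp.single y 1) ω = ω.eval x - ω.eval y := by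
  rw [integral, Finsupp.sum_sub_index (by intros; push_cast; ring),
    Finsupp.sum_single_index (by simp), Finsupp.sum_single_index (by simp)]
  simp

theorem continuousOn_eval_pair {D : Set ℂ} {x y : ℂ → ℂ} (hx : ContinuousOn x D)
    (hy : ContinuousOn y D) (A : MvPolynomial (Fin 2) ℂ) :
    ContinuousOn (fun t => eval ![x t, y t] A) D :=
  (MvPolynomial.continuous_eval A).comp_continuousOn <| by
    rw [continuousOn_pi]
    intro i
    fin_cases i
    · exact hx
    · exact hy

/-- The points `(x(t), y(t))` are smooth points of the curve `(f(x) - f(y)) / (x - y) = 0`, so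
that they all stay on one side of a factorization of this polynomial. -/
theorem eval_eq_zero_and_eval_ne_zero {D : Set ℂ} (hD : IsPreconnected D) {x y : ℂ → ℂ}
    (hx : ContinuousOn x D) (hy : ContinuousOn y D) {f : Polynomial ℂ}
    {R A : MvPolynomial (Fin 2) ℂ}
    (h : Polynomial.aeval (X 0) f - Polynomial.aeval (X 1) f = (X 0 - X 1) * (R * A))
    (hxy : ∀ t ∈ D, x t ≠ y t) (hf : ∀ t ∈ D, f.eval (x t) = f.eval (y t))
    (hf' : ∀ t ∈ D, f.derivative.eval (x t) ≠ 0) (hR : ∃ t ∈ D, eval ![x t, y t] R ≠ 0) :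
    ∀ t ∈ D, eval ![x t, y t] A = 0 ∧ eval ![x t, y t] R ≠ 0 := by
  have h0 : ∀ t ∈ D, eval ![x t, y t] R = 0 ∨ eval ![x t, y t] A = 0 := by
    intro t ht
    have h1 := congrArg (eval ![x t, y t]) h
    simp only [map_sub, map_mul, eval_polynomial_aeval_X, eval_X, Matrix.cons_val_zero,
      Matrix.cons_val_one, hf t ht, sub_self] at h1
    exact mul_eq_zero.1 ((mul_eq_zero.1 h1.symm).resolve_left (sub_ne_zero.2 (hxy t ht)))
  have hne : ∀ t ∈ D, eval ![x t, y t] A = 0 → eval ![x t, y t] R ≠ 0 := fun t ht hA hR =>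
    hf' t ht (derivative_eval_eq_zero_of_factors_eq_zero h hR hA)
  suffices hA : ∀ t ∈ D, eval ![x t, y t] A = 0 from fun t ht => ⟨hA t ht, hne t ht (hA t ht)⟩
  intro t ht
  by_contra hAt
  -- The image of `D` lies in the union of the two coordinate axes and misses the origin, so, being
  -- connected, it lies in one axis.
  let F : ℂ → ℂ × ℂ := fun t => (eval ![x t, y t] R, eval ![x t, y t] A)
  have hF : IsPreconnected (F '' D) := hD.image F
    ((continuousOn_eval_pair hx hy R).prodMk (continuousOn_eval_pair hx hy A))
  obtain ⟨t₀, ht₀, hR₀⟩ := hR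
  obtain ⟨_, ⟨s, hs, rfl⟩, hs1, hs2⟩ := isPreconnected_closed_iff.1 hF {p | p.1 = 0} {p | p.2 = 0}
    (isClosed_eq continuous_fst continuous_const) (isClosed_eq continuous_snd continuous_const)
    (by rintro _ ⟨s, hs, rfl⟩; exact h0 s hs)
    ⟨_, ⟨t, ht, rfl⟩, (h0 t ht).resolve_right hAt⟩
    ⟨_, ⟨t₀, ht₀, rfl⟩, (h0 t₀ ht₀).resolve_left hR₀⟩
  exact hne s hs hs2 hs1

theorem two_mul_card_zeros_le {f ω : Polynomial ℂ} {D : Set ℂ} (hD : IsPreconnected D)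
    {x y : ℂ → ℂ} (hx : ContinuousOn x D) (hy : ContinuousOn y D)
    (hcrit : Disjoint D (criticalValues f)) (hfx : ∀ t ∈ D, f.eval (x t) = t)
    (hfy : ∀ t ∈ D, f.eval (y t) = t) (hxy : ∀ t ∈ D, x t ≠ y t)
    (hω : ∃ t ∈ D, ω.eval (x t) - ω.eval (y t) ≠ 0) (T : Finset ℂ)
    (hT : ∀ t ∈ T, t ∈ D ∧ ω.eval (x t) - ω.eval (y t) = 0) :
    2 * T.card ≤ (f.natDegree - 1) * (ω.natDegree - 1) := by
  classical
  obtain ⟨t₀, ht₀, hωt₀⟩ := hω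
  have hω0 : ω.natDegree ≠ 0 := by
    intro h
    rw [Polynomial.eq_C_of_natDegree_eq_zero h] at hωt₀
    simp at hωt₀
  have hf'x : ∀ t ∈ D, f.derivative.eval (x t) ≠ 0 := fun t ht h =>
    Set.disjoint_left.1 hcrit ht ⟨x t, h, hfx t ht⟩
  have hf'y : ∀ t ∈ D, f.derivative.eval (y t) ≠ 0 := fun t ht h =>
    Set.disjoint_left.1 hcrit ht ⟨y t, h, hfy t ht⟩
  have hf0 : f.natDegree ≠ 0 := by
    intro h
    rw [Polynomial.eq_C_of_natDegree_eq_zero h] at hf'x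
    exact hf'x t₀ ht₀ (by simp)
  obtain ⟨P, hP0, hPdeg, hP⟩ := exists_dividedDifference f hf0
  obtain ⟨Q, hQ0, hQdeg, hQ⟩ := exists_dividedDifference ω hω0
  obtain ⟨A, B, R, hAB, rfl, rfl⟩ := UniqueFactorizationMonoid.exists_reduced_factors P hP0 Q
  have hR0 := left_ne_zero_of_mul hP0
  have hA0 := right_ne_zero_of_mul hP0
  have hB0 := right_ne_zero_of_mul hQ0
  have evalQ : ∀ a b : ℂ, ω.eval a - ω.eval b =
      (a - b) * (eval ![a, b] R * eval ![a, b] B) := by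
    intro a b
    simpa [eval_polynomial_aeval_X] using congrArg (eval ![a, b]) hQ
  have key : ∀ u v : ℂ → ℂ, ContinuousOn u D → ContinuousOn v D →
      (∀ t ∈ D, f.eval (u t) = t) → (∀ t ∈ D, f.eval (v t) = t) → (∀ t ∈ D, u t ≠ v t) →
      (∀ t ∈ D, f.derivative.eval (u t) ≠ 0) → ω.eval (u t₀) - ω.eval (v t₀) ≠ 0 →
      ∀ t ∈ D, ω.eval (u t) - ω.eval (v t) = 0 →
        eval ![u t, v t] A = 0 ∧ eval ![u t, v t] B = 0 := by
    intro u v hu hv hfu hfv huv hf'u hωuv t ht hωt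
    obtain ⟨hA, hR⟩ := eval_eq_zero_and_eval_ne_zero hD hu hv hP huv
      (fun t ht => (hfu t ht).trans (hfv t ht).symm) hf'u
      ⟨t₀, ht₀, fun h => hωuv (by rw [evalQ, h]; simp)⟩ t ht
    rw [evalQ] at hωt
    exact ⟨hA, ((mul_eq_zero.1 ((mul_eq_zero.1 hωt).resolve_left
      (sub_ne_zero.2 (huv t ht)))).resolve_left hR)⟩
  -- Applying `f` to a coordinate recovers `t`, so each set has as many points as `T`, and a common
  -- point would force `x t = y t`.
  let S₁ := T.image fun t => ![x t, y t]
  let S₂ := T.image fun t => ![y t, x t]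
  have hS₁ : S₁.card = T.card := Finset.card_image_of_injOn fun s hs t ht hst => by
    rw [← hfx s (hT s hs).1, ← hfx t (hT t ht).1]
    exact congrArg f.eval (congrFun hst 0)
  have hS₂ : S₂.card = T.card := Finset.card_image_of_injOn fun s hs t ht hst => by
    rw [← hfy s (hT s hs).1, ← hfy t (hT t ht).1]
    exact congrArg f.eval (congrFun hst 0)
  have hS : Disjoint S₁ S₂ := by
    rw [Finset.disjoint_left]
    intro _ h1 h2
    obtain ⟨s, hs, rfl⟩ := Finset.mem_image.1 h1
    obtain ⟨t, ht, hst⟩ := Finset.mem_image.1 h2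
    have h0 : y t = x s := congrFun hst 0
    have : t = s := by rw [← hfy t (hT t ht).1, h0, hfx s (hT s hs).1]
    subst this
    exact hxy t (hT t ht).1 h0.symm
  have hcard := card_le_totalDegree_mul_of_isRelPrime hB0 hAB (S₁ ∪ S₂) (by
    intro s hs
    rcases Finset.mem_union.1 hs with hs | hs
    · obtain ⟨t, ht, rfl⟩ := Finset.mem_image.1 hs
      exact key x y hx hy hfx hfy hxy hf'x hωt₀ t (hT t ht).1 (hT t ht).2
    · obtain ⟨t, ht, rfl⟩ := Finset.mem_image.1 hs
      refine key y x hy hx hfy hfx (fun t ht => (hxy t ht).symm) hf'y ?_ t (hT t ht).1 ?_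
      · rw [← neg_sub]; exact neg_ne_zero.2 hωt₀
      · rw [← neg_sub, (hT t ht).2, neg_zero])
  rw [Finset.card_union_of_disjoint hS, hS₁, hS₂, ← two_mul] at hcard
  rw [totalDegree_mul_of_isDomain hR0 hA0] at hPdeg
  rw [totalDegree_mul_of_isDomain hR0 hB0] at hQdeg
  exact hcard.trans (Nat.mul_le_mul (by omega) (by omega))

theorem le_of_mem_zeroCounts {m n : ℕ} {K : Subfield ℂ} {N : ℕ∞} (hN : N ∈ zeroCounts m n K) :
    N ≤ ((m - 1) * (n - 1) / 2 : ℕ) := by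
  obtain ⟨f, ω, D, γ, -, -, hf, hω, ⟨-, hD⟩, hcrit, ⟨x, y, hx, hy, hγ⟩, ⟨t₀, ht₀, hne⟩, rfl⟩ := hN
  have hI : ∀ t ∈ D, integral (γ t) ω = ω.eval (x t) - ω.eval (y t) := fun t ht => by
    rw [(hγ t ht).2.2.2, integral_single_sub_single]
  by_contra! hlt
  -- Choosing exactly one zero too many also covers an infinite zero set.
  obtain ⟨T, hTs, hTc⟩ := Set.exists_subset_encard_eq (Order.add_one_le_of_lt hlt)
  have hTfin : T.Finite := Set.finite_of_encard_eq_coe (k := (m - 1) * (n - 1) / 2 + 1)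
    (by rw [hTc]; push_cast; rfl)
  have h := two_mul_card_zeros_le hD.isPathConnected.isConnected.isPreconnected hx hy hcrit
    (fun t ht => (hγ t ht).1) (fun t ht => (hγ t ht).2.1) (fun t ht => (hγ t ht).2.2.1)
    ⟨t₀, ht₀, by rwa [← hI t₀ ht₀]⟩ hTfin.toFinset (fun t ht => by
      obtain ⟨-, htD, ht0⟩ := hTs (hTfin.mem_toFinset.1 ht)
      exact ⟨htD, by rwa [← hI t htD]⟩)
  have hc : hTfin.toFinset.card = (m - 1) * (n - 1) / 2 + 1 := by
    rw [hTfin.encard_eq_coe_toFinset_card] at hTc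
    exact_mod_cast hTc
  have := Nat.mul_le_mul (Nat.sub_le_sub_right hf 1) (Nat.sub_le_sub_right hω 1)
  omega

/-! ### The lower bound. -/

/-- On `f = x ^ m`, with `x(t) = t ^ (1 / m)` and `y(t) = ζ x(t)` in the right half plane. -/
theorem exists_mem_zeroCounts_ge {m n : ℕ} (hm : 2 ≤ m) (hn : 1 ≤ n) :
    ∃ N ∈ zeroCounts m n ⊤, ((n - n / m - 1 : ℕ) : ℕ∞) ≤ N := by
  classical
  have hm0 : m ≠ 0 := by omega
  obtain ⟨ζ, hζ⟩ : ∃ ζ : ℂ, IsPrimitiveRoot ζ m := ⟨_, Complex.isPrimitiveRoot_exp m hm0⟩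
  -- Exponents divisible by `m` contribute nothing, since then `ζ ^ k = 1`.
  let E := {k ∈ Finset.Ioc 0 n | ¬ m ∣ k}
  have hE : E.card = n - n / m := by
    have h := Finset.card_filter_add_card_filter_not (s := Finset.Ioc 0 n) (fun k => m ∣ k)
    rw [Nat.Ioc_filter_dvd_card_eq_div, Nat.card_Ioc] at h
    change n / m + E.card = _ at h
    omega
  have hlt : n / m < n := Nat.div_lt_self hn hm
  -- Values of the integral at `x(t) = j + 1`: one condition fewer than unknowns, hence a nonzero
  -- kernel.
  let L : (E → ℂ) →ₗ[ℂ] (Fin (n - n / m - 1) → ℂ) :=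
    LinearMap.pi fun j => ∑ k : E, ((1 - ζ ^ (k : ℕ)) * ((j : ℂ) + 1) ^ (k : ℕ)) •
      LinearMap.proj k
  obtain ⟨b, hb, hb0⟩ := (LinearMap.ker L).exists_mem_ne_zero_of_ne_bot
    (LinearMap.ker_ne_bot_of_finrank_lt (by
      rw [Module.finrank_fintype_fun_eq_card, Module.finrank_fintype_fun_eq_card,
        Fintype.card_coe, hE, Fintype.card_fin]
      omega))
  obtain ⟨k₀, hk₀⟩ := Function.ne_iff.1 hb0
  let ω : Polynomial ℂ := ∑ k : E, Polynomial.monomial (k : ℕ) (b k)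
  let Q : Polynomial ℂ := ∑ k : E, Polynomial.monomial (k : ℕ) (b k * (1 - ζ ^ (k : ℕ)))
  have hQ : ∀ s : ℂ, ω.eval s - ω.eval (ζ * s) = Q.eval s := by
    intro s
    simp only [ω, Q, Polynomial.eval_finsetSum, Polynomial.eval_monomial]
    rw [← Finset.sum_sub_distrib]
    exact Finset.sum_congr rfl fun k _ => by ring
  have hQ0 : Q ≠ 0 := by
    intro h
    have h1 : Q.coeff k₀ = b k₀ * (1 - ζ ^ (k₀ : ℕ)) := by
      simp only [Q, Polynomial.finsetSum_coeff, Polynomial.coeff_monomial]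
      rw [Finset.sum_eq_single k₀]
      · simp
      · intro k _ hk
        rw [if_neg fun h => hk (Subtype.ext h)]
      · simp
    rw [h, Polynomial.coeff_zero, eq_comm, mul_eq_zero, sub_eq_zero, eq_comm (a := (1 : ℂ)),
      hζ.pow_eq_one_iff_dvd] at h1
    exact h1.elim hk₀ (Finset.mem_filter.1 k₀.2).2
  -- Convex, without the only critical value `0`, and containing each `(j + 1) ^ m`, whose principal
  -- root is `j + 1`.
  let D : Set ℂ := {t | 0 < t.re}
  let x : ℂ → ℂ := fun t => t ^ ((m : ℂ)⁻¹)
  have hxm : ∀ t, x t ^ m = t := fun t => Complex.cpow_nat_inv_pow t hm0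
  have hDne : ∀ t ∈ D, t ≠ 0 := by
    rintro t ht rfl
    simp [D] at ht
  have hxpow : ∀ j : ℕ, x (((j : ℂ) + 1) ^ m) = (j : ℂ) + 1 := by
    intro j
    have h : ((j : ℂ) + 1) = (((j : ℝ) + 1 : ℝ) : ℂ) := by push_cast; rfl
    have hpos : (0 : ℝ) ≤ (j : ℝ) + 1 := by positivity
    simp only [x]
    rw [h, ← Complex.ofReal_pow, ← Complex.ofReal_natCast m, ← Complex.ofReal_inv,
      ← Complex.ofReal_cpow (by positivity), Real.pow_rpow_inv_natCast hpos hm0]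
  have hDpow : ∀ j : ℕ, ((j : ℂ) + 1) ^ m ∈ D := by
    intro j
    have h : ((j : ℂ) + 1) ^ m = ((((j : ℝ) + 1) ^ m : ℝ) : ℂ) := by push_cast; rfl
    change 0 < (((j : ℂ) + 1) ^ m).re
    rw [h, Complex.ofReal_re]
    positivity
  have hxcont : ContinuousOn x D := fun t ht =>
    (continuousAt_cpow_const (Or.inl ht)).continuousWithinAt
  have hinj : Function.Injective fun j : ℕ => ((j : ℂ) + 1) ^ m := by
    intro i j hij
    have h := congrArg x hij
    simp only [hxpow] at h
    exact_mod_cast add_right_cancel h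
  have hI : ∀ t, integral (Finsupp.single (x t) 1 - Finsupp.single (ζ * x t) 1) ω =
      Q.eval (x t) := fun t => by rw [integral_single_sub_single, hQ]
  refine ⟨_, ⟨Polynomial.X ^ m, ω, D,
    fun t => Finsupp.single (x t) 1 - Finsupp.single (ζ * x t) 1, fun _ => trivial,
    fun _ => trivial, by simp, ?_, ⟨?_, ?_⟩, ?_, ?_, ?_, rfl⟩, ?_⟩
  · refine Polynomial.natDegree_sum_le_of_forall_le _ _ fun k _ =>
      (Polynomial.natDegree_monomial_le _).trans ?_
    exact (Finset.mem_Ioc.1 (Finset.mem_filter.1 k.2).1).2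
  · exact isOpen_lt continuous_const Complex.continuous_re
  · have hconv : Convex ℝ D := convex_halfSpace_re_gt 0
    have := hconv.contractibleSpace ⟨1, by simp [D]⟩
    exact (inferInstance : SimplyConnectedSpace D)
  · rw [Set.disjoint_left]
    rintro t ht ⟨z, hz, hzt⟩
    apply hDne t ht
    rw [Polynomial.derivative_X_pow, Polynomial.eval_mul, Polynomial.eval_C, Polynomial.eval_pow,
      Polynomial.eval_X, mul_eq_zero] at hz
    rw [← hzt, Polynomial.eval_pow, Polynomial.eval_X,
      eq_zero_of_pow_eq_zero (hz.resolve_left (Nat.cast_ne_zero.2 hm0)), zero_pow hm0]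
  · refine ⟨x, fun t => ζ * x t, hxcont, continuousOn_const.mul hxcont,
      fun t ht => ⟨?_, ?_, ?_, rfl⟩⟩
    · simp [fibre, hxm]
    · simp [fibre, mul_pow, hxm, hζ.pow_eq_one]
    · intro h
      have hx0 : x t ≠ 0 := fun h0 => hDne t ht (by rw [← hxm t, h0, zero_pow hm0])
      exact hζ.ne_one (by omega) (mul_right_cancel₀ hx0 (by rw [one_mul]; exact h.symm))
  -- Otherwise `Q ≠ 0` would vanish at every positive integer.
  · by_contra! h
    refine hQ0 (Polynomial.eq_zero_of_infinite_isRoot Q (Set.infinite_of_injective_forall_mem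
      (f := fun j : ℕ => ((j : ℂ) + 1)) (fun i j hij => by simpa using hij) fun j => ?_))
    have := h _ (hDpow j)
    rwa [hI, hxpow] at this
  · let S := (Finset.range (n - n / m - 1)).image fun j : ℕ => ((j : ℂ) + 1) ^ m
    have hS : S.card = n - n / m - 1 := by
      rw [Finset.card_image_of_injective _ hinj, Finset.card_range]
    rw [← hS, ← Set.encard_coe_eq_coe_finsetCard]
    refine Set.encard_le_encard fun t ht => ?_
    obtain ⟨j, hj, rfl⟩ := Finset.mem_image.1 (Finset.mem_coe.1 ht)
    refine ⟨trivial, hDpow j, ?_⟩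
    rw [hI, hxpow]
    have h := congrFun (LinearMap.mem_ker.1 hb) ⟨j, Finset.mem_range.1 hj⟩
    simp only [L, LinearMap.pi_apply, LinearMap.sum_apply, LinearMap.smul_apply,
      LinearMap.proj_apply, smul_eq_mul, Pi.zero_apply] at h
    simp only [Q, Polynomial.eval_finsetSum, Polynomial.eval_monomial]
    rw [← h]
    exact Finset.sum_congr rfl fun k _ => by ring

end ZeroDimHilbert

theorem theorem1 (m n : ℕ) (hm : 1 ≤ m) (hn : 1 ≤ n) :
    (((n : ℝ) - 1 - (⌊(n : ℝ) / (m : ℝ)⌋ : ℝ) : ℝ) : EReal) ≤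
        ((ZeroDimHilbert.Z m n ⊤ : ENNReal) : EReal) ∧
      ((ZeroDimHilbert.Z m n ⊤ : ENNReal) : EReal) ≤
        ((((m : ℝ) - 1) * ((n : ℝ) - 1) / 2 : ℝ) : EReal) := by
  have hcast : ∀ k : ℕ, (((k : ℕ∞) : ENNReal) : EReal) = ((k : ℝ) : EReal) := fun k => by
    rw [ENat.toENNReal_coe]
    rfl
  have hmono : ∀ {a b : ℕ∞}, a ≤ b → ((a : ENNReal) : EReal) ≤ ((b : ENNReal) : EReal) :=
    fun h => EReal.coe_ennreal_le_coe_ennreal_iff.2 (ENat.toENNReal_le.2 h)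
  have hfloor : (⌊(n : ℝ) / (m : ℝ)⌋ : ℝ) = ((n / m : ℕ) : ℝ) := by
    rw [← Nat.floor_div_eq_div (K := ℝ), natCast_floor_eq_intCast_floor (by positivity)]
  constructor
  · rw [hfloor]
    rcases hm.eq_or_lt with rfl | hm2
    -- For `m = 1` the lower bound is `-1`.
    · refine le_trans ?_ (EReal.coe_ennreal_nonneg _)
      rw [Nat.div_one]
      exact_mod_cast (by linarith : (n : ℝ) - 1 - n ≤ 0)
    · obtain ⟨N, hN, hle⟩ := ZeroDimHilbert.exists_mem_zeroCounts_ge hm2 hn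
      refine le_trans ?_ (hmono (hle.trans (le_sSup hN)))
      -- Ensures that the subtraction in `ℕ` is not truncated.
      have hlt : n / m < n := Nat.div_lt_self hn hm2
      rw [hcast, EReal.coe_le_coe_iff, Nat.sub_sub, Nat.cast_sub (by omega)]
      push_cast
      linarith
  · have hZ : ZeroDimHilbert.Z m n ⊤ ≤ ((m - 1) * (n - 1) / 2 : ℕ) :=
      sSup_le fun N hN => ZeroDimHilbert.le_of_mem_zeroCounts hN
    refine (hmono hZ).trans ?_
    rw [hcast, EReal.coe_le_coe_iff]
    refine Nat.cast_div_le.trans (le_of_eq ?_)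
    push_cast [hm, hn]
    ring
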